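/- **Conventions.** A set $X\subset\mathbf R^N$ is *semianalytic* if every point of $\mathbf R^N$ has an open neighbourhood $V$ such that $X\cap V$ is a finite Boolean combination of sets $\{x\in V: g(x)=0\}$ and $\{x\in V: h(x)>0\}$ with $g,h$ real analytic on $V$. It is *subanalytic* if every point of $\mathbf R^N$ has an open neighbourhood $V$ such that $X\cap V$ is the image of a bounded semianalytic subset of some $\mathbf R^{N+m}$ under the projection to $\mathbf R^N$. A mapping $f:U\to\mathbf R^n$ on an open set $U\subset\mathbf R^m$ is *tame* if its graph is subanalytic or is definable in some o-minimal structure on $(\mathbf R,<)$. For $f:U\to\mathbf R^n$ with $U\subset\mathbf R^n$ open, $\widehat B(f)\subset U$ denotes the set of points at which $f$ is not differentiable, or is differentiable with singular differential. A map fixing $0$ is a *homeomorphism germ* at $0$ if it restricts to a homeomorphism from some open neighbourhood of $0$ onto some open neighbourhood of $0$. **Proposition 7.1.** Let $U$ be an open neighbourhood of $0$ in $\mathbf R^2$ and let $f:U\to\mathbf R^2$ be a continuous tame mapping with $\widehat B(f)\subset\{0\}$ and $f^{-1}(0)=\{0\}$. If $$df:U\setminus\{0\}\to\mathrm{GL}(2,\mathbf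 R)$$ is continuous and null-homotopic (homotopic, through continuous maps into $\mathrm{GL}(2,\mathbf R)$, to a constant map), then $f$ is a homeomorphism germ at $0$. (The assumptions $\widehat B(f)\subset\{0\}$ and continuity of $df$ say together that $f$ is a local $C^1$-diffeomorphism off the origin.) **The analogous statement fails for $n=3$.** Let $f:\mathbf R^3\to\mathbf R^3$ be defined by $$f(x,y,z)=\Bigl(\tfrac{x(x^2-3y^2)}{x^2+y^2},\ \tfrac{y(3x^2-y^2)}{x^2+y^2},\ z\Bigr)\ \text{ if }(x,y)\neq(0,0),\qquad f(0,0,z)=(0,0,z).$$ Then $f$ is continuous and tame, $\widehat B(f)$ is the $z$-axis, $f^{-1}(0)=\{0\}$, and $df:\mathbf R^3\setminus\widehat B(f)\to\mathrm{GL}(3,\mathbf R)$ is continuous and null-homotopic, but $f$ is not a homeomorphism germ at $0$. -/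

import Mathlib

namespace TameMap

/-- A structure on `ℝ` (a first-order language together with its interpretation) is o-minimal if
the order is definable and every subset of `ℝ` that is definable with parameters is a finite union
of points and intervals. The order-connected subsets of `ℝ` are exactly the intervals, bounded or
not, with or without end points, including the points and the empty set. -/
structure IsOMinimal (L : FirstOrder.Language.{0, 0}) [L.Structure ℝ] : Prop where
  definable_lt : (Set.univ : Set ℝ).Definable₂ L {p : ℝ × ℝ | p.1 < p.2}
  finite_union : ∀ s : Set ℝ, (Set.univ : Set ℝ).Definable₁ L s →
    ∃ F : Set (Set ℝ), F.Finite ∧ (∀ I ∈ F, I.OrdConnected) ∧ s = ⋃₀ F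

/-- The sets `{x ∈ U : g x = 0}` and `{x ∈ U : g x > 0}` with `g` real analytic on `U`. -/
def basicAnalyticSets {ι : Type} [Fintype ι] (U : Set (ι → ℝ)) : Set (Set (ι → ℝ)) :=
  {s | ∃ g : (ι → ℝ) → ℝ, AnalyticOnNhd ℝ g U ∧
    (s = {x | x ∈ U ∧ g x = 0} ∨ s = {x | x ∈ U ∧ 0 < g x})}

/-- `X` is semianalytic if every point of the ambient space has an open neighbourhood `U` in which
`X` is a finite Boolean combination of sets `{g = 0}` and `{g > 0}` with `g` analytic on `U`.
(The Boolean operations are carried out in the whole space and the result is cut down to `U`, which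
amounts to carrying them out in `U`.) -/
def IsSemianalytic {ι : Type} [Fintype ι] (X : Set (ι → ℝ)) : Prop :=
  ∀ x : ι → ℝ, ∃ U : Set (ι → ℝ), IsOpen U ∧ x ∈ U ∧
    ∃ A ∈ BooleanSubalgebra.closure (basicAnalyticSets U), X ∩ U = A ∩ U

/-- `X` is subanalytic if every point of the ambient space has an open neighbourhood `U` such that
`X ∩ U` is the projection of a bounded semianalytic set. -/
def IsSubanalytic {ι : Type} [Fintype ι] (X : Set (ι → ℝ)) : Prop :=
  ∀ x : ι → ℝ, ∃ U : Set (ι → ℝ), IsOpen U ∧ x ∈ U ∧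
    ∃ (m : ℕ) (Y : Set (ι ⊕ Fin m → ℝ)), Bornology.IsBounded Y ∧ IsSemianalytic Y ∧
      X ∩ U = (fun y : ι ⊕ Fin m → ℝ => fun i => y (Sum.inl i)) '' Y

/-- The graph of `f : U → ℝⁿ`, `U ⊆ ℝᵐ`, as a subset of `ℝᵐ × ℝⁿ`. -/
def graphOn {m n : ℕ} (f : EuclideanSpace ℝ (Fin m) → EuclideanSpace ℝ (Fin n))
    (U : Set (EuclideanSpace ℝ (Fin m))) : Set (Fin m ⊕ Fin n → ℝ) :=
  {p | ∃ x ∈ U, p = Sum.elim (fun i => x i) (fun j => f x j)}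

/-- `f : U → ℝⁿ` is tame: its graph is definable in some o-minimal structure, or subanalytic. -/
def IsTameOn {m n : ℕ} (f : EuclideanSpace ℝ (Fin m) → EuclideanSpace ℝ (Fin n))
    (U : Set (EuclideanSpace ℝ (Fin m))) : Prop :=
  (∃ (L : FirstOrder.Language.{0, 0}) (_ : L.Structure ℝ),
      IsOMinimal L ∧ (Set.univ : Set ℝ).Definable L (graphOn f U)) ∨
    IsSubanalytic (graphOn f U)

/-- The Jacobi matrix `(∂fᵢ/∂xⱼ)` of `f` at `x`, meaningful where `f` is differentiable. -/
noncomputable def jacobi {n : ℕ} (f : EuclideanSpace ℝ (Fin n) → EuclideanSpace ℝ (Fin n))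
    (x : EuclideanSpace ℝ (Fin n)) : Matrix (Fin n) (Fin n) ℝ :=
  Matrix.of fun i j => fderiv ℝ f x (EuclideanSpace.single j 1) i

/-- The set `B̂(f)` of the points of the open set `U` at which `f` is not differentiable, or is
differentiable with singular differential. -/
def criticalSet {n : ℕ} (f : EuclideanSpace ℝ (Fin n) → EuclideanSpace ℝ (Fin n))
    (U : Set (EuclideanSpace ℝ (Fin n))) : Set (EuclideanSpace ℝ (Fin n)) :=
  {x | x ∈ U ∧ (¬ DifferentiableAt ℝ f x ∨ (jacobi f x).det = 0)}

/-- `x ↦ df(x)` is a continuous map from `S` to `GL(n, ℝ)`, and it is homotopic to a constant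
map. Intended for sets `S` at whose points `f` is differentiable. -/
def NullhomotopicDifferentialOn {n : ℕ}
    (f : EuclideanSpace ℝ (Fin n) → EuclideanSpace ℝ (Fin n))
    (S : Set (EuclideanSpace ℝ (Fin n))) : Prop :=
  ∃ D : C(S, Matrix.GeneralLinearGroup (Fin n) ℝ),
    (∀ x : S, ((D x : Matrix.GeneralLinearGroup (Fin n) ℝ) : Matrix (Fin n) (Fin n) ℝ) =
      jacobi f x) ∧
    D.Nullhomotopic

/-- The germ of `f` at `0` is the germ of a homeomorphism `(ℝⁿ, 0) → (ℝⁿ, 0)`: `f` agrees with a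
homeomorphism from an open neighbourhood of `0` to an open neighbourhood of `0` that fixes `0`. -/
def IsHomeomorphGerm {n : ℕ} (f : EuclideanSpace ℝ (Fin n) → EuclideanSpace ℝ (Fin n)) : Prop :=
  ∃ e : OpenPartialHomeomorph (EuclideanSpace ℝ (Fin n)) (EuclideanSpace ℝ (Fin n)),
    0 ∈ e.source ∧ e 0 = 0 ∧ Set.EqOn f e e.source

open scoped Classical in
/-- The `3`-sheeted covering of `ℝ³` by itself, branched along the third coordinate axis. -/
noncomputable def threeSheeted (p : EuclideanSpace ℝ (Fin 3)) : EuclideanSpace ℝ (Fin 3) :=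
  if p 0 = 0 ∧ p 1 = 0 then !₂[0, 0, p 2]
  else !₂[p 0 * ((p 0) ^ 2 - 3 * (p 1) ^ 2) / ((p 0) ^ 2 + (p 1) ^ 2),
    p 1 * (3 * (p 0) ^ 2 - (p 1) ^ 2) / ((p 0) ^ 2 + (p 1) ^ 2), p 2]

end TameMap

/-! In the plane, compactness makes `f` a covering over a small punctured disc, so `exp` lifts
through `f` to a map `g` on a left half-plane, with `f ∘ g = exp`. If `f` winds `m` times along a
small circle, then `g` has period `2πmi`. Once `m = 1`, `g` depends only on `exp w`, which makes `f`
injective near `0`. To find `m`, consider the pulled-back radial field `df(x)⁻¹ f(x)` along the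
circle and compute its winding number twice. It is the derivative of `g` in the real direction along
the curve `ℓ` that `g` maps to the circle, hence the limit of the chords `(g(ℓ) - g(ℓ - t)) / t`.
These never vanish, because `|f ∘ g|` strictly increases to the right. For large `t` the point `g(ℓ
- t)` is close to `0`, so the chord winds like the circle itself: once
(`winding_eq_one_of_contracting`). On the other hand, a null-homotopy `H` of `df` deforms the field
through `H⁻¹ f` to `M⁻¹ f` with `M` constant. With `M` normalised to the identity, this winds `m`
times. Hence `m = 1` (`exists_injOn_ball_of_differential_homotopy`). In space, the map multiplies
the angle `φ` about the axis by `3`, and its differential is `R(φ)² · R(φ) diag(1,3,1) R(φ)⁻¹`. The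
loop `R²` is contractible in `SO(3)`, although not in `SO(2)`, so the differential is null-homotopic
while the map is three-to-one off the axis. -/

section

open Complex Set Filter Topology Metric

/-! ### Winding numbers of closed curves in the punctured plane. -/

/-- `k : ℝ → ℂ` is the exponential of a continuous function which grows by `2πmi` over every
period `2π`; equivalently `k` is a closed curve of period `2π` with winding number `m` about `0`. -/
def HasWinding (k : ℝ → ℂ) (m : ℤ) : Prop :=
  ∃ μ : ℝ → ℂ, Continuous μ ∧ (∀ θ, exp (μ θ) = k θ) ∧
    ∀ θ, μ (θ + 2 * Real.pi) = μ θ + m * (2 * Real.pi * I)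

theorem eq_of_exp_eq_one {A : Type*} [TopologicalSpace A] [PreconnectedSpace A] {h : A → ℂ}
    (hc : Continuous h) (h1 : ∀ a, exp (h a) = 1) (a b : A) : h a = h b :=
  isCoveringMap_exp.const_of_comp hc (fun a a' => Subtype.ext (by simp [h1])) a b

theorem HasWinding.unique {k : ℝ → ℂ} {m n : ℤ} (hm : HasWinding k m) (hn : HasWinding k n) :
    m = n := by
  obtain ⟨μ, hμ, hμk, hμp⟩ := hm
  obtain ⟨ν, hν, hνk, hνp⟩ := hn
  have h := eq_of_exp_eq_one (hμ.sub hν)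
    (fun θ => by simp [exp_sub, hμk, ← hνk, exp_ne_zero]) (0 + 2 * Real.pi) 0
  simp only [Pi.sub_apply, hμp, hνp] at h
  have h2 : ((m : ℂ) - n) * (2 * Real.pi * I) = 0 := by linear_combination h
  have h3 := (mul_eq_zero.1 h2).resolve_right two_pi_I_ne_zero
  exact_mod_cast sub_eq_zero.1 h3

/-- The increment over a period is continuous with values in the discrete set `2πiℤ`, hence
constant. -/
theorem exists_hasWinding {μ : ℝ → ℂ} (hμ : Continuous μ)
    (hp : ∀ θ, exp (μ (θ + 2 * Real.pi)) = exp (μ θ)) :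
    ∃ m : ℤ, ∀ θ, μ (θ + 2 * Real.pi) = μ θ + m * (2 * Real.pi * I) := by
  have h1 : ∀ θ, exp (μ (θ + 2 * Real.pi) - μ θ) = 1 := fun θ => by
    rw [exp_sub, hp, div_self (exp_ne_zero _)]
  obtain ⟨m, hm⟩ := exp_eq_one_iff.1 (h1 0)
  refine ⟨m, fun θ => ?_⟩
  have := eq_of_exp_eq_one (h := fun θ => μ (θ + 2 * Real.pi) - μ θ) (by fun_prop) h1 θ 0
  simp only [hm] at this
  linear_combination this

/-- A logarithm of the whole homotopy exists on the simply connected plane of pairs `(s, θ)`. Its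
increment over a period is constant in both variables. -/
theorem HasWinding.of_homotopy {k : ℝ → ℝ → ℂ} {a b : ℝ}
    (hk : ContinuousOn (Function.uncurry k) (Icc a b ×ˢ univ))
    (h0 : ∀ s ∈ Icc a b, ∀ θ, k s θ ≠ 0)
    (hp : ∀ s ∈ Icc a b, ∀ θ, k s (θ + 2 * Real.pi) = k s θ)
    {s t : ℝ} (hs : s ∈ Icc a b) (ht : t ∈ Icc a b) {m : ℤ} (hm : HasWinding (k s) m) :
    HasWinding (k t) m := by
  have hab : a ≤ b := hs.1.trans hs.2
  -- Clamping the parameter to `[a, b]` extends the homotopy to all of `ℝ × ℝ`.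
  have hKc : Continuous fun x : ℝ × ℝ => k (projIcc a b hab x.1) x.2 := by
    have : Continuous fun x : ℝ × ℝ => ((projIcc a b hab x.1 : ℝ), x.2) :=
      ((continuous_subtype_val.comp continuous_projIcc).comp continuous_fst).prodMk continuous_snd
    exact hk.comp_continuous this fun x => mk_mem_prod (projIcc a b hab x.1).2 (mem_univ _)
  let K : C(ℝ × ℝ, ℂ) := ⟨_, hKc⟩
  have hK : ∀ x, K x = k (projIcc a b hab x.1) x.2 := fun _ => rfl
  obtain ⟨Λ, ⟨-, hΛ⟩, -⟩ := isCoveringMapOn_exp.existsUnique_continuousMap_lifts K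
    (a₀ := (s, 0)) (e₀ := log (K (s, 0))) (exp_log (h0 _ (projIcc a b hab s).2 _))
    (fun x => h0 _ (projIcc a b hab x.1).2 _)
  have hΛ' : ∀ u ∈ Icc a b, ∀ θ, exp (Λ (u, θ)) = k u θ := fun u hu θ => by
    have := congrFun hΛ (u, θ)
    simpa [hK, projIcc_of_mem hab hu] using this
  have hD : ∀ u θ : ℝ, Λ (u, θ + 2 * Real.pi) - Λ (u, θ) =
      Λ (s, 0 + 2 * Real.pi) - Λ (s, 0) := fun u θ =>
    eq_of_exp_eq_one (h := fun x : ℝ × ℝ => Λ (x.1, x.2 + 2 * Real.pi) - Λ x) (by fun_prop)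
      (fun x => by
        have h1 := congrFun hΛ (x.1, x.2 + 2 * Real.pi)
        have h2 := congrFun hΛ x
        simp only [Function.comp_apply] at h1 h2
        rw [exp_sub, h1, h2, hK, hK, hp _ (projIcc a b hab x.1).2,
          div_self (h0 _ (projIcc a b hab x.1).2 _)]) (u, θ) (s, 0)
  obtain ⟨n, hn⟩ := exists_hasWinding (μ := fun θ => Λ (s, θ)) (by fun_prop)
    (fun θ => by rw [hΛ' s hs, hΛ' s hs, hp s hs])
  have hmn : m = n := hm.unique ⟨fun θ => Λ (s, θ), by fun_prop, hΛ' s hs, hn⟩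
  refine ⟨fun θ => Λ (t, θ), by fun_prop, hΛ' t ht, fun θ => ?_⟩
  rw [hmn]
  linear_combination hD t θ + hn 0

/-! ### Lifts on half-planes, coverings and local inverses. -/

/-- The half-plane of the complex numbers with real part less than `c`. -/
def leftHalfPlane (c : ℝ) : Set ℂ := {z | z.re < c}

theorem mem_leftHalfPlane {c : ℝ} {z : ℂ} : z ∈ leftHalfPlane c ↔ z.re < c := Iff.rfl

theorem isOpen_leftHalfPlane (c : ℝ) : IsOpen (leftHalfPlane c) :=
  isOpen_lt continuous_re continuous_const

theorem convex_leftHalfPlane (c : ℝ) : Convex ℝ (leftHalfPlane c) :=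
  convex_halfSpace_re_lt c

/-- A half-plane is contractible and locally path connected, so the lifting criterion applies.
Outside the half-plane the lift takes the junk value `e`. -/
theorem IsCoveringMapOn.exists_lift_leftHalfPlane {E X : Type*} [TopologicalSpace E]
    [TopologicalSpace X] {p : E → X} {s : Set X} (hp : IsCoveringMapOn p s) {c : ℝ} {φ : ℂ → X}
    (hφ : ContinuousOn φ (leftHalfPlane c)) (hs : MapsTo φ (leftHalfPlane c) s) {a : ℂ}
    (ha : a ∈ leftHalfPlane c) {e : E} (he : p e = φ a) :
    ∃ F : ℂ → E, ContinuousOn F (leftHalfPlane c) ∧ F a = e ∧ EqOn (p ∘ F) φ (leftHalfPlane c) := by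
  have : ContractibleSpace (leftHalfPlane c) := (convex_leftHalfPlane c).contractibleSpace ⟨a, ha⟩
  have : LocallyPathConnectedSpace (leftHalfPlane c) :=
    (isOpen_leftHalfPlane c).locallyPathConnectedSpace
  obtain ⟨F, ⟨hF0, hF⟩, -⟩ := hp.existsUnique_continuousMap_lifts
    (A := leftHalfPlane c) ⟨(leftHalfPlane c).domRestrict φ, hφ.domRestrict⟩
    (a₀ := ⟨a, ha⟩) (e₀ := e) he (fun x => hs x.2)
  classical
  let G : ℂ → E := fun z => if h : z ∈ leftHalfPlane c then F ⟨z, h⟩ else e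
  have hG : ∀ z : leftHalfPlane c, G z = F z := fun z => by simp [G]
  refine ⟨G, ?_, by rw [← hF0]; exact hG ⟨a, ha⟩, fun z hz => ?_⟩
  · rw [continuousOn_iff_continuous_domRestrict]
    exact F.continuous.congr fun z => (hG z).symm
  · rw [Function.comp_apply, hG ⟨z, hz⟩]
    exact congrFun hF ⟨z, hz⟩

theorem IsCoveringMapOn.eqOn_leftHalfPlane {E X : Type*} [TopologicalSpace E]
    [TopologicalSpace X] {p : E → X} {s : Set X} (hp : IsCoveringMapOn p s) {c : ℝ} {F G : ℂ → E}
    (hF : ContinuousOn F (leftHalfPlane c)) (hG : ContinuousOn G (leftHalfPlane c))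
    (hs : MapsTo (p ∘ F) (leftHalfPlane c) s)
    (h : EqOn (p ∘ F) (p ∘ G) (leftHalfPlane c)) {a : ℂ}
    (ha : a ∈ leftHalfPlane c) (haa : F a = G a) : EqOn F G (leftHalfPlane c) := by
  have hGs : MapsTo (p ∘ G) (leftHalfPlane c) s := hs.congr h
  have : PreconnectedSpace (leftHalfPlane c) :=
    isPreconnected_iff_preconnectedSpace.1 (convex_leftHalfPlane c).isPreconnected
  have key := hp.isCoveringMap_restrictPreimage.eq_of_comp_eq (A := leftHalfPlane c)
    (g₁ := fun z => ⟨F z, hs z.2⟩) (g₂ := fun z => ⟨G z, hGs z.2⟩)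
    (hF.domRestrict.subtype_mk _) (hG.domRestrict.subtype_mk _)
    (funext fun z => Subtype.ext (h z.2)) ⟨a, ha⟩ (Subtype.ext haa)
  intro z hz
  exact congrArg Subtype.val (congrFun key ⟨z, hz⟩)

/-- Compactness of the closed ball makes a local homeomorphism over `s` a covering there. The fibres
over `s` avoid the boundary sphere, so the inverse function theorem applies at all their points. -/
theorem isCoveringMapOn_restrict_closedBall {f : ℂ → ℂ} {r : ℝ} {s : Set ℂ}
    (hf : ContinuousOn f (closedBall 0 r))
    (hs : ∀ x ∈ closedBall (0 : ℂ) r, f x ∈ s →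
      x ∈ ball (0 : ℂ) r ∧ ∃ A : ℂ ≃L[ℝ] ℂ, HasStrictFDerivAt f (A : ℂ →L[ℝ] ℂ) x) :
    IsCoveringMapOn ((closedBall (0 : ℂ) r).domRestrict f) s := by
  have : CompactSpace (closedBall (0 : ℂ) r) := isCompact_iff_compactSpace.1 (isCompact_closedBall _ _)
  refine .of_isLocalHomeomorphOn hf.domRestrict fun x hx => ?_
  obtain ⟨hxb, A, hA⟩ := hs x x.2 hx
  have hj : IsOpenEmbedding (inclusion (ball_subset_closedBall (x := (0 : ℂ)) (ε := r))) := by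
    refine ⟨.inclusion _, ?_⟩
    rw [range_inclusion]
    exact isOpen_ball.preimage continuous_subtype_val
  have hf1 : IsLocalHomeomorphOn f {(x : ℂ)} := fun y hy =>
    ⟨hA.toOpenPartialHomeomorph f, hy ▸ hA.mem_toOpenPartialHomeomorph_source, rfl⟩
  have hf2 : IsLocalHomeomorphOn ((closedBall (0 : ℂ) r).domRestrict f ∘
      inclusion ball_subset_closedBall) {⟨x, hxb⟩} :=
    hf1.comp (g := f) (f := ((↑) : ball (0 : ℂ) r → ℂ))
      (isOpen_ball.isOpenEmbedding_subtypeVal.isLocalHomeomorph.isLocalHomeomorphOn)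
      (by rintro y rfl; rfl)
  exact hf2.of_comp_right hj.isLocalHomeomorph.isLocalHomeomorphOn x ⟨⟨x, hxb⟩, rfl, rfl⟩

/-- A local inverse of `exp` composed with `f` is a local left inverse of `g` with invertible
differential, so `g` inherits differentiability from mere continuity. -/
theorem exists_hasStrictFDerivAt_of_comp_eq_exp {f g : ℂ → ℂ} {w : ℂ} {A : ℂ ≃L[ℝ] ℂ}
    (hg : ContinuousAt g w) (hf : HasStrictFDerivAt f (A : ℂ →L[ℝ] ℂ) (g w))
    (hfg : ∀ᶠ y in 𝓝 w, f (g y) = exp y) :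
    ∃ G : ℂ →L[ℝ] ℂ, HasStrictFDerivAt g G w ∧ G 1 = A.symm (exp w) := by
  have hE0 := (hasStrictDerivAt_exp w).hasStrictFDerivAt_equiv (exp_ne_zero w)
  set E : ℂ ≃L[ℝ] ℂ :=
    (ContinuousLinearEquiv.unitsEquivAut ℂ (Units.mk0 (exp w) (exp_ne_zero w))).restrictScalars ℝ
    with hEdef
  have hE : HasStrictFDerivAt exp (E : ℂ →L[ℝ] ℂ) w := hE0.restrictScalars ℝ
  have hE1 : E 1 = exp w := by simp [hEdef]
  have hφ : HasStrictFDerivAt (hE.localInverse exp E w ∘ f)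
      ((A.trans E.symm : ℂ ≃L[ℝ] ℂ) : ℂ →L[ℝ] ℂ) (g w) := by
    have h1 := hE.to_localInverse
    rw [← hfg.self_of_nhds] at h1
    exact h1.comp (g w) hf
  have hinv : ∀ᶠ y in 𝓝 w, (hE.localInverse exp E w ∘ f) (g y) = y := by
    filter_upwards [hfg, hE.eventually_left_inverse] with y h1 h2
    rw [Function.comp_apply, h1, h2]
  exact ⟨_, hφ.of_local_left_inverse hg hinv, by simp [hE1]⟩

/-! ### The winding number of the pulled-back radial field. -/

/-- At `t = 0` both end points of the chord vary with `θ`, which is why strict differentiability is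
required. -/
theorem continuousOn_backward_quotient {g : ℂ → ℂ} {c T : ℝ} {ℓ v : ℝ → ℂ}
    (hg : ContinuousOn g (leftHalfPlane c)) (hℓ : Continuous ℓ) (hℓc : ∀ θ, ℓ θ ∈ leftHalfPlane c)
    (hv : Continuous v)
    (hder : ∀ θ, ∃ G : ℂ →L[ℝ] ℂ, HasStrictFDerivAt g G (ℓ θ) ∧ G 1 = v θ) :
    ContinuousOn (Function.uncurry fun t θ : ℝ =>
      if t = 0 then v θ else (g (ℓ θ) - g (ℓ θ - t)) / t) (Icc 0 T ×ˢ univ) := by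
  rintro ⟨t₀, θ₀⟩ ⟨ht₀, -⟩
  obtain rfl | hne := eq_or_ne t₀ 0
  · refine ContinuousAt.continuousWithinAt ?_
    obtain ⟨G, hG, hG1⟩ := hder θ₀
    rw [ContinuousAt, Metric.tendsto_nhds]
    intro ε hε
    have hlo := (hasStrictFDerivAt_iff_isLittleO.1 hG).def (half_pos hε)
    have htend : Tendsto (fun p : ℝ × ℝ => (ℓ p.2, ℓ p.2 - (p.1 : ℂ))) (𝓝 (0, θ₀))
        (𝓝 (ℓ θ₀, ℓ θ₀)) := by
      have : Continuous fun p : ℝ × ℝ => (ℓ p.2, ℓ p.2 - (p.1 : ℂ)) := by fun_prop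
      simpa using this.tendsto (0, θ₀)
    have hvt : Tendsto (fun p : ℝ × ℝ => v p.2) (𝓝 (0, θ₀)) (𝓝 (v θ₀)) :=
      (hv.comp continuous_snd).tendsto ((0 : ℝ), θ₀)
    filter_upwards [htend.eventually hlo, Metric.tendsto_nhds.1 hvt ε hε] with ⟨t, θ⟩ h1 h2
    simp only [Function.uncurry_apply_pair, if_true]
    split_ifs with ht
    · exact h2
    · have ht' : (t : ℂ) ≠ 0 := ofReal_ne_zero.2 ht
      have hGt : G (t : ℂ) = t * v θ₀ := by
        rw [← hG1, ← real_smul, ← G.map_smul, real_smul, mul_one]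
      simp only [sub_sub_cancel, hGt] at h1
      rw [dist_eq_norm]
      have : (g (ℓ θ) - g (ℓ θ - t)) / t - v θ₀ = (g (ℓ θ) - g (ℓ θ - t) - t * v θ₀) / t := by
        field_simp
      rw [this, norm_div]
      have hpos : 0 < ‖(t : ℂ)‖ := norm_pos_iff.2 ht'
      rw [div_lt_iff₀ hpos]
      nlinarith
  · have hpos : 0 < t₀ := lt_of_le_of_ne ht₀.1 hne.symm
    refine ContinuousAt.continuousWithinAt ?_
    have hmem : ℓ θ₀ - (t₀ : ℂ) ∈ leftHalfPlane c := by
      have := hℓc θ₀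
      simp only [mem_leftHalfPlane, sub_re, ofReal_re] at this ⊢
      linarith
    have h1 : ContinuousAt (fun p : ℝ × ℝ => g (ℓ p.2)) (t₀, θ₀) :=
      ContinuousAt.comp (f := fun p : ℝ × ℝ => ℓ p.2) (x := (t₀, θ₀))
        (hg.continuousAt ((isOpen_leftHalfPlane c).mem_nhds (hℓc θ₀))) (by fun_prop)
    have h2 : ContinuousAt (fun p : ℝ × ℝ => g (ℓ p.2 - (p.1 : ℂ))) (t₀, θ₀) :=
      ContinuousAt.comp (f := fun p : ℝ × ℝ => ℓ p.2 - (p.1 : ℂ)) (x := (t₀, θ₀))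
        (hg.continuousAt ((isOpen_leftHalfPlane c).mem_nhds hmem)) (by fun_prop)
    have h3 : ContinuousAt (fun p : ℝ × ℝ => (p.1 : ℂ)) (t₀, θ₀) := by fun_prop
    refine ((h1.sub h2).div h3 (ofReal_ne_zero.2 hne)).congr ?_
    have : ∀ᶠ p : ℝ × ℝ in 𝓝 (t₀, θ₀), p.1 ≠ 0 :=
      continuous_fst.continuousAt.eventually_ne hne
    filter_upwards [this] with p hp
    simp [Function.uncurry, hp]

/-- The field `N 0` has winding number `1` as the limit of the chords of `g`, and the homotopy `N`
carries it to `exp ∘ ℓ`, whose winding number is `m`. -/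
theorem winding_eq_one_of_contracting {g : ℂ → ℂ} {c x₀ : ℝ} {ℓ : ℝ → ℂ} {m : ℤ} {N : ℝ → ℝ → ℂ}
    (hg : ContinuousOn g (leftHalfPlane c))
    (hinj : ∀ w ∈ leftHalfPlane c, ∀ t : ℝ, 0 < t → g (w - t) ≠ g w)
    (hper : ∀ w ∈ leftHalfPlane c, g (w + m * (2 * Real.pi * I)) = g w)
    (hg0 : ∀ δ > 0, ∃ b : ℝ, ∀ w ∈ leftHalfPlane b, ‖g w‖ < δ)
    (hℓ : Continuous ℓ) (hℓc : ∀ θ, ℓ θ ∈ leftHalfPlane c)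
    (hℓm : ∀ θ, ℓ (θ + 2 * Real.pi) = ℓ θ + m * (2 * Real.pi * I))
    (hgℓ : ∀ θ, g (ℓ θ) = exp (x₀ + θ * I))
    (hder : ∀ θ, ∃ G : ℂ →L[ℝ] ℂ, HasStrictFDerivAt g G (ℓ θ) ∧ G 1 = N 0 θ)
    (hN : ContinuousOn (Function.uncurry N) (Icc 0 1 ×ˢ univ))
    (hN0 : ∀ s ∈ Icc (0 : ℝ) 1, ∀ θ, N s θ ≠ 0)
    (hNp : ∀ s ∈ Icc (0 : ℝ) 1, ∀ θ, N s (θ + 2 * Real.pi) = N s θ)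
    (hN1 : ∀ θ, N 1 θ = exp (ℓ θ)) : m = 1 := by
  have h01 : (0 : ℝ) ∈ Icc (0 : ℝ) 1 := ⟨le_rfl, zero_le_one⟩
  have h11 : (1 : ℝ) ∈ Icc (0 : ℝ) 1 := ⟨zero_le_one, le_rfl⟩
  have hexp : ∀ θ : ℝ, exp (x₀ + ((θ + 2 * Real.pi : ℝ) : ℂ) * I) = exp (x₀ + θ * I) := fun θ => by
    rw [← exp_periodic (x₀ + θ * I)]
    congr 1
    push_cast
    ring
  have hsub : ∀ (t : ℝ), 0 ≤ t → ∀ θ, ℓ θ - (t : ℂ) ∈ leftHalfPlane c := fun t ht θ => by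
    have := hℓc θ
    simp only [mem_leftHalfPlane, sub_re, ofReal_re] at this ⊢
    linarith
  have hgper : ∀ (t : ℝ), 0 ≤ t → ∀ θ,
      g (ℓ (θ + 2 * Real.pi) - (t : ℂ)) = g (ℓ θ - t) := fun t ht θ => by
    rw [hℓm, ← hper _ (hsub t ht θ)]
    congr 1
    ring
  obtain ⟨b, hb⟩ := hg0 _ (Real.exp_pos x₀)
  -- A shift by `c - b` moves `ℓ` to where `g` is smaller than the radius `exp x₀`; the maximum with
  -- `1` keeps `T` positive.
  set T : ℝ := max (c - b) 1 with hT
  have hTpos : 0 < T := lt_of_lt_of_le one_pos (le_max_right _ _)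
  have hTne : (T : ℂ) ≠ 0 := ofReal_ne_zero.2 hTpos.ne'
  have hTb : ∀ θ, ‖g (ℓ θ - T)‖ < Real.exp x₀ := fun θ => hb _ (by
    have h1 := hℓc θ
    have h2 : c - b ≤ T := le_max_left _ _
    simp only [mem_leftHalfPlane, sub_re, ofReal_re] at h1 ⊢
    linarith)
  have hgT : Continuous fun θ => g (ℓ θ - T) :=
    hg.comp_continuous (by fun_prop) (hsub T hTpos.le)
  -- the circle divided by `T`
  have w0 : HasWinding (fun θ => (exp (x₀ + θ * I) - (0 : ℝ) * g (ℓ θ - T)) / T) 1 := by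
    refine ⟨fun θ => x₀ - Real.log T + θ * I, by fun_prop, fun θ => ?_, fun θ => ?_⟩
    · beta_reduce
      rw [show (x₀ : ℂ) - Real.log T + θ * I = x₀ + θ * I - Real.log T by ring, exp_sub,
        ← ofReal_exp, Real.exp_log hTpos]
      simp
    · push_cast
      ring
  -- Subtracting `s * g (ℓ θ - T)` cannot reach zero, since this term is shorter than the radius of
  -- the circle.
  have w1 : HasWinding (fun θ => (exp (x₀ + θ * I) - (1 : ℝ) * g (ℓ θ - T)) / T) 1 := by
    refine HasWinding.of_homotopy (a := 0) (b := 1)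
      (k := fun s θ => (exp (x₀ + θ * I) - (s : ℂ) * g (ℓ θ - T)) / T) ?_ ?_ ?_ h01 h11 w0
    · have : Continuous fun p : ℝ × ℝ => g (ℓ p.2 - T) := hgT.comp continuous_snd
      refine Continuous.continuousOn ?_
      exact ((by fun_prop : Continuous fun p : ℝ × ℝ => exp (x₀ + p.2 * I)).sub
        ((continuous_ofReal.comp continuous_fst).mul this)).div_const _
    · intro s hs θ
      refine div_ne_zero (sub_ne_zero.2 fun h => ?_) hTne
      have h1 := congrArg norm h
      rw [norm_exp, norm_mul, norm_real, Real.norm_of_nonneg hs.1] at h1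
      simp only [add_re, ofReal_re, mul_re, I_re, mul_zero, ofReal_im, I_im, mul_one, sub_self,
        add_zero] at h1
      nlinarith [hTb θ, hs.2, norm_nonneg (g (ℓ θ - T)), hs.1]
    · intro s hs θ
      simp only [hexp, hgper T hTpos.le]
  have hv : Continuous (N 0) := hN.comp_continuous (f := fun θ : ℝ => ((0 : ℝ), θ)) (by fun_prop)
    fun θ => mk_mem_prod h01 (mem_univ _)
  -- Shrinking the chord length parameter from `T` to `0` turns chords into the derivative.
  have w2 : HasWinding (N 0) 1 := by
    have := HasWinding.of_homotopy (a := 0) (b := T) (s := T) (t := 0) (m := 1)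
      (k := fun t θ : ℝ => if t = 0 then N 0 θ else (g (ℓ θ) - g (ℓ θ - t)) / t)
      (continuousOn_backward_quotient hg hℓ hℓc hv hder) ?_ ?_ ⟨hTpos.le, le_rfl⟩
      ⟨le_rfl, hTpos.le⟩ (by simpa [hTpos.ne', hgℓ] using w1)
    · simpa using this
    · intro t ht θ
      split_ifs with h
      · exact hN0 0 h01 θ
      · exact div_ne_zero (sub_ne_zero.2 (hinj _ (hℓc θ) t (lt_of_le_of_ne ht.1 (Ne.symm h))).symm)
          (ofReal_ne_zero.2 h)
    · intro t ht θ
      rw [hNp 0 h01, hgper t ht.1, hgℓ, hgℓ, hexp]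
  have w3 : HasWinding (N 1) 1 := HasWinding.of_homotopy hN hN0 hNp h01 h11 w2
  exact HasWinding.unique ⟨ℓ, hℓ, fun θ => (hN1 θ).symm, hℓm⟩ w3

/-- By compactness `‖f‖` has a positive minimum on the ball minus its `δ`-neighbourhood of `0`. -/
theorem exists_pos_forall_norm_lt {f : ℂ → ℂ} {r : ℝ} (hc : ContinuousOn f (closedBall 0 r))
    (hne : ∀ x ∈ closedBall (0 : ℂ) r, f x = 0 → x = 0) {δ : ℝ} (hδ : 0 < δ) :
    ∃ ε > 0, ∀ x ∈ closedBall (0 : ℂ) r, ‖f x‖ < ε → ‖x‖ < δ := by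
  have hcpt : IsCompact (closedBall (0 : ℂ) r \ ball 0 δ) := (isCompact_closedBall _ _).diff isOpen_ball
  obtain hem | hnem := (closedBall (0 : ℂ) r \ ball 0 δ).eq_empty_or_nonempty
  · refine ⟨1, one_pos, fun x hx _ => ?_⟩
    simpa using sdiff_eq_empty.1 hem hx
  · obtain ⟨x₁, hx₁, hmin⟩ := hcpt.exists_isMinOn hnem (hc.mono sdiff_subset).norm
    refine ⟨‖f x₁‖, norm_pos_iff.2 fun h => hx₁.2 ?_, fun x hx hlt => ?_⟩
    · rw [hne _ hx₁.1 h]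
      exact mem_ball_self hδ
    · by_contra hcon
      exact not_le.2 hlt (hmin ⟨hx, by simpa using hcon⟩)

/-- The null-homotopy enters only through `K`, a nowhere zero deformation of the field `df⁻¹ f` to
`f`; this forces the covering to have one sheet. -/
theorem exists_injOn_ball_of_differential_homotopy {f : ℂ → ℂ} {r : ℝ} (hr : 0 < r)
    (hc : ContinuousOn f (closedBall 0 r)) (hf0 : f 0 = 0)
    (hne : ∀ x ∈ closedBall (0 : ℂ) r, f x = 0 → x = 0) {A : ℂ → ℂ ≃L[ℝ] ℂ}
    (hA : ∀ x ∈ closedBall (0 : ℂ) r, x ≠ 0 → HasStrictFDerivAt f (A x : ℂ →L[ℝ] ℂ) x)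
    {K : ℝ → ℂ → ℂ}
    (hK : ContinuousOn (Function.uncurry K) (Icc 0 1 ×ˢ (closedBall 0 r \ {0})))
    (hKne : ∀ s ∈ Icc (0 : ℝ) 1, ∀ x ∈ closedBall (0 : ℂ) r \ {0}, K s x ≠ 0)
    (hK0 : ∀ x ∈ closedBall (0 : ℂ) r \ {0}, K 0 x = (A x).symm (f x))
    (hK1 : ∀ x ∈ closedBall (0 : ℂ) r \ {0}, K 1 x = f x) :
    ∃ η > 0, η ≤ r ∧ InjOn f (ball 0 η) ∧ ∀ δ > 0, f '' ball 0 δ ∈ 𝓝 0 := by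
  obtain ⟨ε, hε, hεr⟩ := exists_pos_forall_norm_lt hc hne hr
  have h0r : (0 : ℂ) ∈ closedBall (0 : ℂ) r := mem_closedBall_self hr.le
  -- a small ball mapped into the ball of radius `ε`
  obtain ⟨η, hη, hηr, hηε⟩ : ∃ η > 0, η ≤ r ∧ ∀ x, ‖x‖ < η → ‖f x‖ < ε := by
    have h1 : ContinuousAt f 0 := hc.continuousAt (closedBall_mem_nhds _ hr)
    obtain ⟨η, hη, h⟩ := Metric.continuousAt_iff.1 h1 ε hε
    refine ⟨min η r, lt_min hη hr, min_le_right _ _, fun x hx => ?_⟩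
    have := h (x := x) (by simpa using hx.trans_le (min_le_left _ _))
    simpa [hf0] using this
  have hsub : ∀ x : ℂ, ‖x‖ < η → x ∈ closedBall (0 : ℂ) r := fun x hx => by
    simpa using (hx.le.trans hηr)
  -- the covering
  have hcov : IsCoveringMapOn ((closedBall (0 : ℂ) r).domRestrict f) (ball 0 ε \ {0}) := by
    refine isCoveringMapOn_restrict_closedBall hc fun x hx hfx => ⟨?_, A x, hA x hx ?_⟩
    · simpa using hεr x hx (by simpa using hfx.1)
    · rintro rfl
      exact hfx.2 hf0
  have hexpη : ∀ z ∈ leftHalfPlane (Real.log η), ‖exp z‖ < η := fun z hz => by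
    rw [norm_exp]
    exact (Real.lt_log_iff_exp_lt hη).1 hz
  have hexpε : MapsTo exp (leftHalfPlane (Real.log ε)) (ball 0 ε \ {0}) := fun z hz =>
    ⟨by rw [mem_ball_zero_iff, norm_exp]; exact (Real.lt_log_iff_exp_lt hε).1 hz, exp_ne_zero z⟩
  have hfe : ∀ z ∈ leftHalfPlane (Real.log η), f (exp z) ≠ 0 := fun z hz h =>
    exp_ne_zero z (hne _ (hsub _ (hexpη z hz)) h)
  have hfec : ContinuousOn (fun z => f (exp z)) (leftHalfPlane (Real.log η)) :=
    hc.comp continuous_exp.continuousOn fun z hz => hsub _ (hexpη z hz)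
  -- The test circle has radius `η / e`; any radius below `η` would do.
  set x₀ : ℝ := Real.log η - 1 with hx₀
  have hline : ∀ θ : ℝ, (x₀ + θ * I : ℂ) ∈ leftHalfPlane (Real.log η) := fun θ => by
    simp [mem_leftHalfPlane, hx₀]
  have hz₀ := hline 0
  -- lifting `f ∘ exp` through `exp`
  obtain ⟨Λ, hΛc, hΛ0, hΛ⟩ := isCoveringMapOn_exp.exists_lift_leftHalfPlane hfec
    (fun z hz => hfe z hz) hz₀ (exp_log (hfe _ hz₀))
  have hΛ' : ∀ z ∈ leftHalfPlane (Real.log η), exp (Λ z) = f (exp z) := hΛ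
  have hΛm : MapsTo Λ (leftHalfPlane (Real.log η)) (leftHalfPlane (Real.log ε)) := fun z hz => by
    rw [mem_leftHalfPlane, Real.lt_log_iff_exp_lt hε, ← norm_exp, hΛ' z hz]
    exact hηε _ (hexpη z hz)
  -- lifting `exp` through `f`
  obtain ⟨g', hgc', hg0', hg'⟩ := hcov.exists_lift_leftHalfPlane continuous_exp.continuousOn hexpε
    (hΛm hz₀) (e := ⟨_, hsub _ (hexpη _ hz₀)⟩) (hΛ' _ hz₀).symm
  set g : ℂ → ℂ := fun w => g' w with hg_def
  have hfg : ∀ w ∈ leftHalfPlane (Real.log ε), f (g w) = exp w := hg'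
  have hgr : ∀ w, g w ∈ closedBall (0 : ℂ) r := fun w => (g' w).2
  have hgc : ContinuousOn g (leftHalfPlane (Real.log ε)) := continuous_subtype_val.comp_continuousOn hgc'
  have hgne : ∀ w ∈ leftHalfPlane (Real.log ε), g w ≠ 0 := fun w hw h => by
    have := hfg w hw
    rw [h, hf0] at this
    exact exp_ne_zero _ this.symm
  -- Both `g ∘ Λ` and `exp` lift `f ∘ exp` through `f`, and they agree at one point. The map `q` is
  -- `exp` with values in the closed ball, padded by `0`.
  have hgΛ : ∀ z ∈ leftHalfPlane (Real.log η), g (Λ z) = exp z := by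
    classical
    let q : ℂ → closedBall (0 : ℂ) r := fun z =>
      if h : exp z ∈ closedBall (0 : ℂ) r then ⟨exp z, h⟩ else ⟨0, h0r⟩
    have hq : ∀ z ∈ leftHalfPlane (Real.log η), (q z : ℂ) = exp z := fun z hz => by
      simp only [q]
      rw [dif_pos (hsub _ (hexpη z hz))]
    have hqc : ContinuousOn q (leftHalfPlane (Real.log η)) := by
      rw [IsEmbedding.subtypeVal.continuousOn_iff]
      exact continuous_exp.continuousOn.congr hq
    have key := hcov.eqOn_leftHalfPlane (F := g' ∘ Λ) (G := q) (hgc'.comp hΛc hΛm) hqc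
      (fun z hz => by
        have : ((closedBall (0 : ℂ) r).domRestrict f ∘ (g' ∘ Λ)) z = exp (Λ z) := hg' (hΛm hz)
        rw [this]
        exact hexpε (hΛm hz))
      (fun z hz => by
        have h1 : ((closedBall (0 : ℂ) r).domRestrict f ∘ (g' ∘ Λ)) z = exp (Λ z) := hg' (hΛm hz)
        have h2 : ((closedBall (0 : ℂ) r).domRestrict f ∘ q) z = f (exp z) := by
          simp only [Function.comp_apply, domRestrict_apply, hq z hz]
        rw [h1, h2, hΛ' z hz]) hz₀ (Subtype.ext (by
          rw [hq _ hz₀, Function.comp_apply, hg0']))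
    intro z hz
    have := congrArg Subtype.val (key hz)
    rwa [hq z hz] at this
  -- the winding number
  set ℓ : ℝ → ℂ := fun θ => Λ (x₀ + θ * I) with hℓ_def
  have hℓ : Continuous ℓ := hΛc.comp_continuous (by fun_prop) hline
  have hℓc : ∀ θ, ℓ θ ∈ leftHalfPlane (Real.log ε) := fun θ => hΛm (hline θ)
  have hexp : ∀ θ : ℝ, exp (x₀ + ((θ + 2 * Real.pi : ℝ) : ℂ) * I) = exp (x₀ + θ * I) := fun θ => by
    rw [← exp_periodic (x₀ + θ * I)]
    congr 1
    push_cast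
    ring
  obtain ⟨m, hm⟩ := exists_hasWinding hℓ fun θ => by
    simp only [hℓ_def]
    rw [hΛ' _ (hline _), hΛ' _ (hline _), hexp]
  have hshift : ∀ (w : ℂ) (n : ℤ), w ∈ leftHalfPlane (Real.log ε) →
      w + n * (2 * Real.pi * I) ∈ leftHalfPlane (Real.log ε) := fun w n hw => by
    simpa [mem_leftHalfPlane] using hw
  have hexpn : ∀ (w : ℂ) (n : ℤ), exp (w + n * (2 * Real.pi * I)) = exp w := fun w n =>
    exp_periodic.int_mul n w
  -- The translate of `g` is again a lift of `exp`. It meets `g` at `ℓ 0`, because `g ∘ ℓ` closes up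
  -- after one turn while `ℓ` advances by `2πmi`.
  have hper : ∀ w ∈ leftHalfPlane (Real.log ε), g (w + m * (2 * Real.pi * I)) = g w := by
    have hF : ∀ w ∈ leftHalfPlane (Real.log ε), ((closedBall (0 : ℂ) r).domRestrict f ∘
        fun w => g' (w + m * (2 * Real.pi * I))) w = exp w := fun w hw => by
      rw [← hexpn w m]
      exact hg' (hshift w m hw)
    have key := hcov.eqOn_leftHalfPlane (F := fun w => g' (w + m * (2 * Real.pi * I))) (G := g')
      (hgc'.comp (by fun_prop) fun w hw => hshift w m hw) hgc'
      (fun w hw => by rw [hF w hw]; exact hexpε hw)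
      (fun w hw => by rw [hF w hw]; exact (hg' hw).symm) (hℓc 0)
      (Subtype.ext (by
        have h1 := hgΛ _ (hline (0 + 2 * Real.pi))
        have h2 := hgΛ _ (hline 0)
        rw [hexp, ← h2] at h1
        rw [← hm 0]
        exact h1))
    exact fun w hw => congrArg Subtype.val (key hw)
  have hg0 : ∀ δ > 0, ∃ b : ℝ, b ≤ Real.log ε ∧ ∀ w ∈ leftHalfPlane b, ‖g w‖ < δ := fun δ hδ => by
    obtain ⟨ε', hε', h⟩ := exists_pos_forall_norm_lt hc hne hδ
    refine ⟨min (Real.log ε) (Real.log ε'), min_le_left _ _, fun w hw => h _ (hgr w) ?_⟩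
    rw [mem_leftHalfPlane] at hw
    rw [hfg w (hw.trans_le (min_le_left _ _)), norm_exp]
    exact (Real.lt_log_iff_exp_lt hε').1 (hw.trans_le (min_le_right _ _))
  have hcirc : ∀ θ : ℝ, exp (x₀ + θ * I) ∈ closedBall (0 : ℂ) r \ {0} := fun θ =>
    ⟨hsub _ (hexpη _ (hline θ)), exp_ne_zero _⟩
  have hm1 : m = 1 := by
    refine winding_eq_one_of_contracting (x₀ := x₀) (N := fun s θ => K s (exp (x₀ + θ * I)))
      hgc ?_ hper (fun δ hδ => ?_) hℓ hℓc hm (fun θ => hgΛ _ (hline θ)) ?_ ?_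
      (fun s hs θ => hKne s hs _ (hcirc θ)) (fun s _ θ => by rw [hexp])
      (fun θ => by rw [hK1 _ (hcirc θ), hΛ' _ (hline θ)])
    -- The points `g w` and `g (w - t)` are told apart by `‖f (g w)‖ = exp (re w)`.
    · intro w hw t ht h
      have hw' : w - t ∈ leftHalfPlane (Real.log ε) := by
        simp only [mem_leftHalfPlane, sub_re, ofReal_re] at hw ⊢
        linarith
      have h1 := congrArg f h
      rw [hfg w hw, hfg _ hw'] at h1
      have h2 := congrArg norm h1
      rw [norm_exp, norm_exp, Real.exp_eq_exp, sub_re, ofReal_re] at h2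
      linarith
    · obtain ⟨b, -, hb⟩ := hg0 δ hδ
      exact ⟨b, hb⟩
    · intro θ
      have hgl : g (ℓ θ) = exp (x₀ + θ * I) := hgΛ _ (hline θ)
      have hnhds := (isOpen_leftHalfPlane (Real.log ε)).mem_nhds (hℓc θ)
      have hst := hA _ (hcirc θ).1 (hcirc θ).2
      rw [← hgl] at hst
      obtain ⟨G, hG, hG1⟩ := exists_hasStrictFDerivAt_of_comp_eq_exp (hgc.continuousAt hnhds) hst
        (by filter_upwards [hnhds] with y hy using hfg y hy)
      refine ⟨G, hG, ?_⟩
      rw [hG1, hK0 _ (hcirc θ), ← hfg _ (hℓc θ), hgl]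
    · have h1 : Continuous fun p : ℝ × ℝ => (p.1, exp (x₀ + p.2 * I)) := by fun_prop
      exact hK.comp h1.continuousOn fun p hp => mk_mem_prod hp.1 (hcirc p.2)
  have hper1 : ∀ (n : ℤ), ∀ w ∈ leftHalfPlane (Real.log ε), g (w + n * (2 * Real.pi * I)) = g w := by
    have hstep : ∀ w ∈ leftHalfPlane (Real.log ε), g (w + 2 * Real.pi * I) = g w := fun w hw => by
      simpa [hm1] using hper w hw
    intro n
    induction n with
    | zero => simp
    | succ n ih =>
      intro w hw
      rw [← ih w hw, ← hstep _ (hshift w n hw)]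
      congr 1
      push_cast
      ring
    | pred n ih =>
      intro w hw
      rw [← ih w hw, ← hstep _ (hshift w _ hw)]
      congr 1
      push_cast
      ring
  refine ⟨η, hη, hηr, fun x hx y hy hxy => ?_, fun δ hδ => ?_⟩
  · rw [mem_ball_zero_iff] at hx hy
    obtain rfl | hx0 := eq_or_ne x 0
    · exact (hne y (hsub y hy) (hxy ▸ hf0)).symm
    obtain rfl | hy0 := eq_or_ne y 0
    · exact hne x (hsub x hx) (hxy ▸ hf0)
    have hlog : ∀ x : ℂ, ‖x‖ < η → x ≠ 0 → log x ∈ leftHalfPlane (Real.log η) := fun x hx hx0 => by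
      rw [mem_leftHalfPlane, log_re]
      exact Real.log_lt_log (norm_pos_iff.2 hx0) hx
    have hlx := hlog x hx hx0
    have hly := hlog y hy hy0
    -- Equal values of `f` give logarithms differing by a multiple of `2πi`, now a period of `g`;
    -- applying `g` recovers `x` and `y`.
    have h1 : exp (Λ (log x)) = exp (Λ (log y)) := by
      rw [hΛ' _ hlx, hΛ' _ hly, exp_log hx0, exp_log hy0, hxy]
    obtain ⟨n, hn⟩ := exp_eq_exp_iff_exists_int.1 h1
    rw [← exp_log hx0, ← exp_log hy0, ← hgΛ _ hlx, ← hgΛ _ hly, hn, hper1 n _ (hΛm hly)]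
  · obtain ⟨b, hbε, hb⟩ := hg0 δ hδ
    filter_upwards [ball_mem_nhds (0 : ℂ) (Real.exp_pos b)] with y hy
    obtain rfl | hy0 := eq_or_ne y 0
    · exact ⟨0, mem_ball_self hδ, hf0⟩
    have hyb : log y ∈ leftHalfPlane b := by
      rw [mem_leftHalfPlane, log_re, Real.log_lt_iff_lt_exp (norm_pos_iff.2 hy0)]
      simpa using hy
    exact ⟨g (log y), by simpa using hb _ hyb, by
      rw [hfg _ (lt_of_lt_of_le (mem_leftHalfPlane.1 hyb) hbε), exp_log hy0]⟩

/-! ### Matrices as linear maps, and transport of the planar result from `ℂ`. -/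

/-- The continuous linear automorphism of `ℝⁿ` given by an invertible matrix. -/
noncomputable def Matrix.GeneralLinearGroup.toEuclideanCLE {n : ℕ} (M : Matrix.GeneralLinearGroup (Fin n) ℝ) :
    EuclideanSpace ℝ (Fin n) ≃L[ℝ] EuclideanSpace ℝ (Fin n) :=
  ContinuousLinearEquiv.unitsEquiv ℝ _
    (Units.map (Matrix.toEuclideanCLM (n := Fin n) (𝕜 := ℝ) : _ →* _) M)

open Matrix.GeneralLinearGroup

theorem coe_toEuclideanCLE {n : ℕ} (M : Matrix.GeneralLinearGroup (Fin n) ℝ) :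
    (toEuclideanCLE M : EuclideanSpace ℝ (Fin n) →L[ℝ] EuclideanSpace ℝ (Fin n)) =
      Matrix.toEuclideanCLM (n := Fin n) (𝕜 := ℝ) M.val :=
  rfl

theorem Matrix.continuous_toEuclideanCLM {n : ℕ} :
    Continuous (Matrix.toEuclideanCLM (n := Fin n) (𝕜 := ℝ)) :=
  LinearMap.continuous_of_finiteDimensional
    (Matrix.toEuclideanCLM (n := Fin n) (𝕜 := ℝ)).toAlgEquiv.toLinearMap

theorem TameMap.fderiv_eq_toEuclideanCLM_jacobi {n : ℕ}
    (f : EuclideanSpace ℝ (Fin n) → EuclideanSpace ℝ (Fin n)) (x : EuclideanSpace ℝ (Fin n)) :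
    fderiv ℝ f x = Matrix.toEuclideanCLM (n := Fin n) (𝕜 := ℝ) (TameMap.jacobi f x) := by
  apply ContinuousLinearMap.coe_injective
  refine (EuclideanSpace.basisFun (Fin n) ℝ).toBasis.ext fun j => ?_
  ext i
  simp [TameMap.jacobi]

theorem TameMap.isHomeomorphGerm_of_injOn {n : ℕ}
    {f : EuclideanSpace ℝ (Fin n) → EuclideanSpace ℝ (Fin n)} {η : ℝ} (hη : 0 < η)
    (hc : ContinuousOn f (ball 0 η)) (hf0 : f 0 = 0) (hinj : InjOn f (ball 0 η))
    (h0 : 𝓝 0 ≤ map f (𝓝 0)) (hne : ∀ x ∈ ball 0 η, x ≠ 0 → 𝓝 (f x) ≤ map f (𝓝 x)) :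
    TameMap.IsHomeomorphGerm f := by
  have ho : IsOpenMap ((ball (0 : EuclideanSpace ℝ (Fin n)) η).domRestrict f) := by
    refine IsOpenMap.of_nhds_le fun x => ?_
    have : map ((ball (0 : EuclideanSpace ℝ (Fin n)) η).domRestrict f) (𝓝 x) = map f (𝓝 (x : _)) := by
      rw [← isOpen_ball.isOpenEmbedding_subtypeVal.map_nhds_eq x, map_map]
      rfl
    rw [this, domRestrict_apply]
    by_cases hx : (x : EuclideanSpace ℝ (Fin n)) = 0
    · rw [hx, hf0]
      exact h0
    · exact hne x x.2 hx
  refine ⟨.ofContinuousOpenRestrict (hinj.toPartialEquiv f _) hc ho isOpen_ball,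
    mem_ball_self hη, hf0, fun x _ => rfl⟩

theorem TameMap.isHomeomorphGerm_of_nullhomotopic {U : Set (EuclideanSpace ℝ (Fin 2))}
    {f : EuclideanSpace ℝ (Fin 2) → EuclideanSpace ℝ (Fin 2)} (hU : IsOpen U) (h0U : 0 ∈ U)
    (hc : ContinuousOn f U) (hcrit : TameMap.criticalSet f U ⊆ {0})
    (hf : {x | x ∈ U ∧ f x = 0} = {0}) (hnull : TameMap.NullhomotopicDifferentialOn f (U \ {0})) :
    TameMap.IsHomeomorphGerm f := by
  obtain ⟨D, hD, M, ⟨H⟩⟩ := hnull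
  have hf0 : f 0 = 0 := (hf.symm.subset rfl : (0 : EuclideanSpace ℝ (Fin 2)) ∈ _).2
  have hfne : ∀ x ∈ U, f x = 0 → x = 0 := fun x hx h => hf.subset ⟨hx, h⟩
  have hdiff : ∀ x ∈ U \ {0}, DifferentiableAt ℝ f x := fun x hx => by
    by_contra h
    exact hx.2 (hcrit ⟨hx.1, Or.inl h⟩)
  have hfd : ∀ x : ↥(U \ {0}), fderiv ℝ f x =
      (toEuclideanCLE (D x) : EuclideanSpace ℝ (Fin 2) →L[ℝ] _) := fun x => by
    rw [TameMap.fderiv_eq_toEuclideanCLM_jacobi, coe_toEuclideanCLE, ← hD]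
  have hopen : IsOpen (U \ {0}) := hU.sdiff isClosed_singleton
  have hfdc : ContinuousOn (fderiv ℝ f) (U \ {0}) := by
    rw [continuousOn_iff_continuous_domRestrict]
    exact (Matrix.continuous_toEuclideanCLM.comp (Units.continuous_val.comp D.continuous)).congr
      fun x => (hfd x).symm
  have hstrict : ∀ x : ↥(U \ {0}), HasStrictFDerivAt f
      (toEuclideanCLE (D x) : EuclideanSpace ℝ (Fin 2) →L[ℝ] _) x := fun x => by
    rw [← hfd]
    refine hasStrictFDerivAt_of_hasFDerivAt_of_continuousAt ?_
      (hfdc.continuousAt (hopen.mem_nhds x.2))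
    filter_upwards [hopen.mem_nhds x.2] with y hy using (hdiff y hy).hasFDerivAt
  obtain ⟨r, hr, hrU⟩ := nhds_basis_closedBall.mem_iff.1 (hU.mem_nhds h0U)
  obtain ⟨eL, henorm⟩ : ∃ eL : ℂ ≃L[ℝ] EuclideanSpace ℝ (Fin 2), ∀ p, ‖eL p‖ = ‖p‖ :=
    ⟨Complex.orthonormalBasisOneI.repr.toContinuousLinearEquiv,
      Complex.orthonormalBasisOneI.repr.norm_map⟩
  obtain ⟨P, hP⟩ : ∃ P, P = toEuclideanCLE M := ⟨_, rfl⟩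
  -- Dividing by the constant end `M` of the homotopy makes the deformed field end at `F` itself.
  -- The start is unaffected, since `dF⁻¹ F` and `df⁻¹ f` agree up to the identification with `ℂ`.
  set F : ℂ → ℂ := fun p => eL.symm (P.symm (f (eL p))) with hF
  have heU : ∀ p ∈ closedBall (0 : ℂ) r, eL p ∈ U := fun p hp => hrU (by
    rw [mem_closedBall_zero_iff] at hp ⊢
    exact (henorm p).trans_le hp)
  have heS : ∀ p ∈ closedBall (0 : ℂ) r \ {0}, eL p ∈ U \ {0} := fun p hp =>
    ⟨heU p hp.1, fun h => hp.2 (by simpa using h)⟩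
  obtain ⟨A, hAdef⟩ : ∃ A : ℂ → ℂ ≃L[ℝ] ℂ, ∀ p, ∀ h : eL p ∈ U \ {0}, A p =
      ((eL.trans (toEuclideanCLE (D ⟨_, h⟩))).trans P.symm).trans eL.symm := by
    classical
    exact ⟨fun p => if h : eL p ∈ U \ {0} then
      ((eL.trans (toEuclideanCLE (D ⟨_, h⟩))).trans P.symm).trans eL.symm else .refl ℝ ℂ,
      fun p h => dif_pos h⟩
  obtain ⟨K, hKdef⟩ : ∃ K : ℝ → ℂ → ℂ, ∀ s : ℝ, ∀ p, ∀ h : eL p ∈ U \ {0}, K s p =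
      eL.symm ((toEuclideanCLE (H (projIcc 0 1 zero_le_one s, ⟨_, h⟩))).symm (f (eL p))) := by
    classical
    exact ⟨fun s p => if h : eL p ∈ U \ {0} then
      eL.symm ((toEuclideanCLE (H (projIcc 0 1 zero_le_one s, ⟨_, h⟩))).symm (f (eL p))) else 0,
      fun s p h => dif_pos h⟩
  have hfc : ContinuousOn (fun p => f (eL p)) (closedBall (0 : ℂ) r) :=
    hc.comp eL.continuous.continuousOn heU
  have hKc : ContinuousOn (Function.uncurry K) (Icc 0 1 ×ˢ (closedBall 0 r \ {0})) := by
    rw [continuousOn_iff_continuous_domRestrict]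
    have h1 : Continuous fun x : ↥(Icc (0 : ℝ) 1 ×ˢ (closedBall (0 : ℂ) r \ {0})) =>
        ((projIcc (0 : ℝ) 1 zero_le_one x.1.1 : unitInterval),
          (⟨eL x.1.2, heS _ x.2.2⟩ : ↥(U \ {0}))) :=
      (continuous_projIcc.comp (continuous_fst.comp continuous_subtype_val)).prodMk
        ((eL.continuous.comp (continuous_snd.comp continuous_subtype_val)).subtype_mk _)
    have h2 := Matrix.continuous_toEuclideanCLM.comp (Units.continuous_val.comp
      (continuous_inv.comp (H.continuous.comp h1)))
    have h3 : Continuous fun x : ↥(Icc (0 : ℝ) 1 ×ˢ (closedBall (0 : ℂ) r \ {0})) => f (eL x.1.2) :=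
      hfc.comp_continuous (continuous_snd.comp continuous_subtype_val) fun x => x.2.2.1
    exact (eL.symm.continuous.comp (h2.clm_apply h3)).congr fun x => (hKdef _ _ (heS _ x.2.2)).symm
  obtain ⟨η, hη, hηr, hinj, himg⟩ := exists_injOn_ball_of_differential_homotopy (f := F) hr
    (eL.symm.continuous.comp_continuousOn (P.symm.continuous.comp_continuousOn hfc))
    (by simp [hF, hf0]) (fun p hp h => by
      simp only [hF, map_eq_zero_iff _ eL.symm.injective, map_eq_zero_iff _ P.symm.injective] at h
      simpa using hfne _ (heU p hp) h) (A := A)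
    (fun p hp hp0 => by
      have h := heS p ⟨hp, hp0⟩
      rw [hAdef p h]
      exact eL.symm.hasStrictFDerivAt.comp p (P.symm.hasStrictFDerivAt.comp p
        ((hstrict ⟨_, h⟩).comp p eL.hasStrictFDerivAt)))
    hKc
    (fun s _ p hp => by
      rw [hKdef s p (heS p hp)]
      simp only [ne_eq, map_eq_zero_iff _ eL.symm.injective,
        map_eq_zero_iff _ (ContinuousLinearEquiv.injective _)]
      exact fun h => (heS p hp).2 (hfne _ (heU p hp.1) h))
    (fun p hp => by
      have h := heS p hp
      rw [hKdef 0 p h, hAdef p h]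
      simp [hF])
    (fun p hp => by
      rw [hKdef 1 p (heS p hp)]
      simp [hF, hP])
  have hfF : ∀ x, f x = P (eL (F (eL.symm x))) := fun x => by simp [hF]
  have hball : ∀ {δ : ℝ} {x}, x ∈ ball (0 : EuclideanSpace ℝ (Fin 2)) δ → eL.symm x ∈ ball (0 : ℂ) δ :=
    fun {δ x} hx => by
      rw [mem_ball_zero_iff] at hx ⊢
      rwa [← henorm, eL.apply_symm_apply]
  have hsub : ball (0 : EuclideanSpace ℝ (Fin 2)) η ⊆ U :=
    (ball_subset_closedBall.trans (closedBall_subset_closedBall hηr)).trans hrU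
  refine TameMap.isHomeomorphGerm_of_injOn hη (hc.mono hsub) hf0 ?_ ?_ fun x hx hx0 => ?_
  · intro x hx y hy hxy
    rw [hfF, hfF] at hxy
    exact eL.symm.injective (hinj (hball hx) (hball hy) (eL.injective (P.injective hxy)))
  · intro W hW
    have h1 : (fun p => f (eL p)) ⁻¹' W ∈ 𝓝 (0 : ℂ) := by
      have : Tendsto eL (𝓝 0) (𝓝 0) := by simpa using eL.continuous.tendsto 0
      exact this hW
    obtain ⟨δ, hδ, hδW⟩ := Metric.mem_nhds_iff.1 h1
    have h2 : Tendsto (fun y => eL.symm (P.symm y)) (𝓝 0) (𝓝 0) := by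
      simpa [Function.comp_def] using (eL.symm.continuous.comp P.symm.continuous).tendsto 0
    filter_upwards [h2 (himg δ hδ)] with y hy
    obtain ⟨p, hp, hpy⟩ := hy
    have : f (eL p) = y := P.symm.injective (eL.symm.injective hpy)
    exact this ▸ hδW hp
  · exact ((hstrict ⟨x, hsub hx, hx0⟩).map_nhds_eq_of_equiv).ge

end

section

open Set Filter Topology Metric

namespace TameMap

/-! ### The branched covering of space: calculus and failure of injectivity. -/

/-- On the axis the quotients are `0 / 0 = 0`, so no case distinction is needed. -/
theorem threeSheeted_eq (p : EuclideanSpace ℝ (Fin 3)) :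
    threeSheeted p = !₂[p 0 * ((p 0) ^ 2 - 3 * (p 1) ^ 2) / ((p 0) ^ 2 + (p 1) ^ 2),
      p 1 * (3 * (p 0) ^ 2 - (p 1) ^ 2) / ((p 0) ^ 2 + (p 1) ^ 2), p 2] := by
  unfold threeSheeted
  split_ifs with h
  · simp [h.1, h.2]
  · rfl

theorem sq_add_sq_ne_zero_of_not_and {x y : ℝ} (h : ¬ (x = 0 ∧ y = 0)) : x ^ 2 + y ^ 2 ≠ 0 :=
  fun h0 => h ⟨by nlinarith [sq_nonneg x, sq_nonneg y], by nlinarith [sq_nonneg x, sq_nonneg y]⟩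

/-- The Jacobi matrix of `threeSheeted` off the third coordinate axis. -/
noncomputable def threeSheetedJacobi (p : EuclideanSpace ℝ (Fin 3)) : Matrix (Fin 3) (Fin 3) ℝ :=
  !![((p 0) ^ 4 + 6 * (p 0) ^ 2 * (p 1) ^ 2 - 3 * (p 1) ^ 4) / ((p 0) ^ 2 + (p 1) ^ 2) ^ 2,
      -8 * (p 0) ^ 3 * p 1 / ((p 0) ^ 2 + (p 1) ^ 2) ^ 2, 0;
    8 * p 0 * (p 1) ^ 3 / ((p 0) ^ 2 + (p 1) ^ 2) ^ 2,
      (3 * (p 0) ^ 4 - 6 * (p 0) ^ 2 * (p 1) ^ 2 - (p 1) ^ 4) / ((p 0) ^ 2 + (p 1) ^ 2) ^ 2, 0;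
    0, 0, 1]

theorem det_threeSheetedJacobi {p : EuclideanSpace ℝ (Fin 3)} (hp : ¬ (p 0 = 0 ∧ p 1 = 0)) :
    (threeSheetedJacobi p).det = 3 := by
  have := sq_add_sq_ne_zero_of_not_and hp
  simp only [threeSheetedJacobi, Matrix.det_fin_three, Matrix.of_apply, Matrix.cons_val]
  field_simp
  ring

theorem hasFDerivAt_threeSheeted {p : EuclideanSpace ℝ (Fin 3)} (hp : ¬ (p 0 = 0 ∧ p 1 = 0)) :
    HasFDerivAt threeSheeted
      (Matrix.toEuclideanCLM (n := Fin 3) (𝕜 := ℝ) (threeSheetedJacobi p)) p := by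
  have hρ := sq_add_sq_ne_zero_of_not_and hp
  have hx : ∀ i, HasFDerivAt (fun q : EuclideanSpace ℝ (Fin 3) => q i)
      (EuclideanSpace.proj i : EuclideanSpace ℝ (Fin 3) →L[ℝ] ℝ) p := fun i =>
    (EuclideanSpace.proj i : EuclideanSpace ℝ (Fin 3) →L[ℝ] ℝ).hasFDerivAt
  have hD := ((hx 0).pow 2).add ((hx 1).pow 2)
  rw [← hasFDerivWithinAt_univ, hasFDerivWithinAt_euclidean]
  intro i
  rw [hasFDerivWithinAt_univ]
  simp only [threeSheeted_eq]
  fin_cases i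
  · refine (((hx 0).mul (((hx 0).pow 2).sub (((hx 1).pow 2).const_mul 3))).mul ((hasDerivAt_inv hρ).comp_hasFDerivAt p hD)).congr_fderiv ?_
    ext v
    simp [threeSheetedJacobi, Matrix.mulVec, dotProduct, Fin.sum_univ_three]
    field_simp
    ring
  · refine (((hx 1).mul ((((hx 0).pow 2).const_mul 3).sub ((hx 1).pow 2))).mul ((hasDerivAt_inv hρ).comp_hasFDerivAt p hD)).congr_fderiv ?_
    ext v
    simp [threeSheetedJacobi, Matrix.mulVec, dotProduct, Fin.sum_univ_three]
    field_simp
    ring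
  · refine (hx 2).congr_fderiv ?_
    ext v
    simp [threeSheetedJacobi, Matrix.mulVec, dotProduct, Fin.sum_univ_three]

theorem jacobi_threeSheeted {p : EuclideanSpace ℝ (Fin 3)} (hp : ¬ (p 0 = 0 ∧ p 1 = 0)) :
    jacobi threeSheeted p = threeSheetedJacobi p := by
  apply (Matrix.toEuclideanCLM (n := Fin 3) (𝕜 := ℝ)).injective
  change Matrix.toEuclideanCLM (n := Fin 3) (𝕜 := ℝ) _ = Matrix.toEuclideanCLM (n := Fin 3) (𝕜 := ℝ) _
  rw [← fderiv_eq_toEuclideanCLM_jacobi, (hasFDerivAt_threeSheeted hp).fderiv]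

/-- Across the axis the first component is homogeneous of degree one but not additive: its slopes
along `(1,0)`, `(0,1)`, `(1,1)` are `1`, `0`, `-1`. -/
theorem not_differentiableAt_threeSheeted {p : EuclideanSpace ℝ (Fin 3)}
    (h0 : p 0 = 0) (h1 : p 1 = 0) : ¬ DifferentiableAt ℝ threeSheeted p := by
  intro h
  have h2 : DifferentiableAt ℝ (fun q => threeSheeted q 0) p := (differentiableAt_euclidean.1 h) 0
  have key : ∀ a b c : ℝ, (∀ t : ℝ, (t * a) * ((t * a) ^ 2 - 3 * (t * b) ^ 2) /
      ((t * a) ^ 2 + (t * b) ^ 2) = t * c) →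
      fderiv ℝ (fun q => threeSheeted q 0) p !₂[a, b, 0] = c := by
    intro a b c hc
    have hl := h2.hasFDerivAt.hasLineDerivAt !₂[a, b, 0]
    refine hl.unique ?_
    unfold HasLineDerivAt
    have : (fun t : ℝ => threeSheeted (p + t • !₂[a, b, 0]) 0) = fun t => t * c := by
      funext t
      rw [← hc t, threeSheeted_eq]
      simp [h0, h1]
    rw [this]
    simpa using (hasDerivAt_id (0 : ℝ)).mul_const c
  have e1 := key 1 0 1 fun t => by
    obtain rfl | ht := eq_or_ne t 0
    · simp
    · field_simp
      ring
  have e2 := key 0 1 0 fun t => by simp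
  have e3 := key 1 1 (-1) fun t => by
    obtain rfl | ht := eq_or_ne t 0
    · simp
    · field_simp
      ring
  have hadd : (!₂[1, 1, 0] : EuclideanSpace ℝ (Fin 3)) = !₂[1, 0, 0] + !₂[0, 1, 0] := by
    ext i
    fin_cases i <;> simp
  rw [hadd, map_add, e1, e2] at e3
  norm_num at e3

theorem criticalSet_threeSheeted : criticalSet threeSheeted univ = {p | p 0 = 0 ∧ p 1 = 0} := by
  ext p
  refine ⟨fun h => ?_, fun h => ⟨mem_univ _, Or.inl (not_differentiableAt_threeSheeted h.1 h.2)⟩⟩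
  by_contra hp
  obtain h | h := h.2
  · exact h (hasFDerivAt_threeSheeted hp).differentiableAt
  · rw [jacobi_threeSheeted hp, det_threeSheetedJacobi hp] at h
    norm_num at h

theorem continuous_mul_div_of_abs_le {X : Type*} [TopologicalSpace X] {a b c : X → ℝ} {C : ℝ}
    (ha : Continuous a) (hb : Continuous b) (hc : Continuous c) (h : ∀ x, |b x| ≤ C * |c x|)
    (h0 : ∀ x, c x = 0 → a x = 0) : Continuous fun x => a x * b x / c x := by
  rw [continuous_iff_continuousAt]
  intro x
  by_cases hx : c x = 0
  · rw [ContinuousAt, hx, div_zero]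
    have hlim : Tendsto (fun y => |a y| * |C|) (𝓝 x) (𝓝 0) := by
      have := (ha.abs.mul_const |C|).tendsto x
      simpa [h0 x hx] using this
    refine squeeze_zero_norm (fun y => ?_) hlim
    rw [Real.norm_eq_abs, abs_div, abs_mul, mul_div_assoc]
    refine mul_le_mul_of_nonneg_left ?_ (abs_nonneg _)
    refine div_le_of_le_mul₀ (abs_nonneg _) (abs_nonneg _) ((h y).trans ?_)
    exact mul_le_mul_of_nonneg_right (le_abs_self _) (abs_nonneg _)
  · exact (ha.continuousAt.mul hb.continuousAt).div hc.continuousAt hx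

theorem continuous_threeSheeted : Continuous threeSheeted := by
  have hp : ∀ i, Continuous fun p : EuclideanSpace ℝ (Fin 3) => p i := fun i => by fun_prop
  have h0 : ∀ p : EuclideanSpace ℝ (Fin 3), (p 0) ^ 2 + (p 1) ^ 2 = 0 → p 0 = 0 ∧ p 1 = 0 :=
    fun p h => by
      by_contra hcon
      exact sq_add_sq_ne_zero_of_not_and hcon h
  have hu := continuous_mul_div_of_abs_le (C := 3) (hp 0)
    (b := fun p => (p 0) ^ 2 - 3 * (p 1) ^ 2) (c := fun p => (p 0) ^ 2 + (p 1) ^ 2)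
    (by fun_prop) (by fun_prop) (fun p => by
      rw [abs_of_nonneg (by positivity : 0 ≤ (p 0) ^ 2 + (p 1) ^ 2), abs_le]
      constructor <;> nlinarith [sq_nonneg (p 0), sq_nonneg (p 1)]) fun p h => (h0 p h).1
  have hv := continuous_mul_div_of_abs_le (C := 3) (hp 1)
    (b := fun p => 3 * (p 0) ^ 2 - (p 1) ^ 2) (c := fun p => (p 0) ^ 2 + (p 1) ^ 2)
    (by fun_prop) (by fun_prop) (fun p => by
      rw [abs_of_nonneg (by positivity : 0 ≤ (p 0) ^ 2 + (p 1) ^ 2), abs_le]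
      constructor <;> nlinarith [sq_nonneg (p 0), sq_nonneg (p 1)]) fun p h => (h0 p h).2
  rw [funext threeSheeted_eq]
  refine (PiLp.continuous_toLp 2 _).comp (continuous_pi fun i => ?_)
  fin_cases i
  · exact hu
  · exact hv
  · exact hp 2

theorem threeSheeted_sq_add_sq (p : EuclideanSpace ℝ (Fin 3)) :
    threeSheeted p 0 ^ 2 + threeSheeted p 1 ^ 2 = (p 0) ^ 2 + (p 1) ^ 2 := by
  rw [threeSheeted_eq]
  simp only [Matrix.cons_val]
  by_cases hp : p 0 = 0 ∧ p 1 = 0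
  · simp [hp.1, hp.2]
  · have := sq_add_sq_ne_zero_of_not_and hp
    field_simp
    ring

theorem threeSheeted_preimage_zero : threeSheeted ⁻¹' {0} = {0} := by
  ext p
  simp only [mem_preimage, mem_singleton_iff]
  constructor
  · intro h
    have h1 := threeSheeted_sq_add_sq p
    have h2 : threeSheeted p 2 = p 2 := by rw [threeSheeted_eq]; rfl
    simp only [h, PiLp.zero_apply] at h1 h2
    have h3 : p 0 = 0 ∧ p 1 = 0 := by
      by_contra hcon
      exact sq_add_sq_ne_zero_of_not_and hcon (by linarith)
    ext i
    fin_cases i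
    · exact h3.1
    · exact h3.2
    · exact h2.symm
  · rintro rfl
    rw [threeSheeted_eq]
    ext i
    fin_cases i <;> simp

theorem not_isHomeomorphGerm_threeSheeted : ¬ IsHomeomorphGerm threeSheeted := by
  rintro ⟨e, h0, -, he⟩
  obtain ⟨ε, hε, hball⟩ := Metric.mem_nhds_iff.1 (e.open_source.mem_nhds h0)
  set a : EuclideanSpace ℝ (Fin 3) := !₂[ε / 2, 0, 0] with ha
  -- This is `a` turned by `2π/3` about the axis; tripling the angle identifies the two.
  set b : EuclideanSpace ℝ (Fin 3) := !₂[-(ε / 4), ε / 4 * √3, 0] with hb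
  have h3 : √3 ^ 2 = (3 : ℝ) := Real.sq_sqrt (by norm_num)
  have hna : a ∈ e.source := hball (by
    rw [mem_ball_zero_iff, EuclideanSpace.norm_eq, Real.sqrt_lt' hε]
    simp [ha, Fin.sum_univ_three]
    nlinarith)
  have hnb : b ∈ e.source := hball (by
    rw [mem_ball_zero_iff, EuclideanSpace.norm_eq, Real.sqrt_lt' hε]
    simp [hb, Fin.sum_univ_three, mul_pow]
    nlinarith)
  have hfa : threeSheeted a = a := by
    rw [threeSheeted_eq]
    ext i
    fin_cases i
    · simp [ha]
      field_simp
    · simp [ha]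
    · simp [ha]
  have hfb : threeSheeted b = a := by
    rw [threeSheeted_eq]
    ext i
    fin_cases i
    · simp [ha, hb, mul_pow]
      field_simp
      ring
    · simp [ha, hb, mul_pow]
      exact Or.inl (Or.inr (by ring))
    · simp [ha, hb]
  have hab : a = b := e.injOn hna hnb (by rw [← he hna, ← he hnb, hfa, hfb])
  have := congrArg (fun p : EuclideanSpace ℝ (Fin 3) => p 0) hab
  simp [ha, hb] at this
  linarith

/-! ### Tameness: the graph is algebraic. -/

/-- Over the axis the cleared denominators make the first two squares vanish identically. The third,
preservation of the distance to the axis, then pins down the value. -/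
theorem mem_graphOn_threeSheeted {p : Fin 3 ⊕ Fin 3 → ℝ} :
    p ∈ graphOn threeSheeted univ ↔
      (p (.inr 0) * ((p (.inl 0)) ^ 2 + (p (.inl 1)) ^ 2) -
          p (.inl 0) * ((p (.inl 0)) ^ 2 - 3 * (p (.inl 1)) ^ 2)) ^ 2 +
        (p (.inr 1) * ((p (.inl 0)) ^ 2 + (p (.inl 1)) ^ 2) -
          p (.inl 1) * (3 * (p (.inl 0)) ^ 2 - (p (.inl 1)) ^ 2)) ^ 2 +
        ((p (.inr 0)) ^ 2 + (p (.inr 1)) ^ 2 - ((p (.inl 0)) ^ 2 + (p (.inl 1)) ^ 2)) ^ 2 +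
        (p (.inr 2) - p (.inl 2)) ^ 2 = 0 := by
  constructor
  · rintro ⟨x, -, rfl⟩
    have h1 := threeSheeted_sq_add_sq x
    simp only [Sum.elim_inr, Sum.elim_inl, h1]
    rw [threeSheeted_eq]
    simp only [Matrix.cons_val]
    by_cases hp : x 0 = 0 ∧ x 1 = 0
    · simp [hp.1, hp.2]
    · have := sq_add_sq_ne_zero_of_not_and hp
      field_simp
      ring
  · intro h
    set x : EuclideanSpace ℝ (Fin 3) := !₂[p (.inl 0), p (.inl 1), p (.inl 2)] with hx
    generalize h1 : p (.inr 0) * ((p (.inl 0)) ^ 2 + (p (.inl 1)) ^ 2) -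
          p (.inl 0) * ((p (.inl 0)) ^ 2 - 3 * (p (.inl 1)) ^ 2) = A at h
    generalize h2 : p (.inr 1) * ((p (.inl 0)) ^ 2 + (p (.inl 1)) ^ 2) -
          p (.inl 1) * (3 * (p (.inl 0)) ^ 2 - (p (.inl 1)) ^ 2) = B at h
    generalize h3 : (p (.inr 0)) ^ 2 + (p (.inr 1)) ^ 2 -
      ((p (.inl 0)) ^ 2 + (p (.inl 1)) ^ 2) = C at h
    generalize h4 : p (.inr 2) - p (.inl 2) = D at h
    have hA : A = 0 := by nlinarith [sq_nonneg A, sq_nonneg B, sq_nonneg C, sq_nonneg D]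
    have hB : B = 0 := by nlinarith [sq_nonneg A, sq_nonneg B, sq_nonneg C, sq_nonneg D]
    have hC : C = 0 := by nlinarith [sq_nonneg A, sq_nonneg B, sq_nonneg C, sq_nonneg D]
    have hD : D = 0 := by nlinarith [sq_nonneg A, sq_nonneg B, sq_nonneg C, sq_nonneg D]
    rw [hA] at h1
    rw [hB] at h2
    rw [hC] at h3
    rw [hD] at h4
    refine ⟨x, mem_univ _, ?_⟩
    have hq : ∀ j, p (.inr j) = threeSheeted x j := by
      rw [threeSheeted_eq]
      by_cases hp : p (.inl 0) = 0 ∧ p (.inl 1) = 0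
      · simp only [hp.1, hp.2] at h3
        have e0 : p (.inr 0) = 0 := by
          nlinarith [sq_nonneg (p (.inr 0)), sq_nonneg (p (.inr 1))]
        have e1 : p (.inr 1) = 0 := by
          nlinarith [sq_nonneg (p (.inr 0)), sq_nonneg (p (.inr 1))]
        intro j
        fin_cases j
        · simp [hx, hp.1, hp.2, e0]
        · simp [hx, hp.1, hp.2, e1]
        · simpa [hx] using sub_eq_zero.1 h4
      · have hρ := sq_add_sq_ne_zero_of_not_and hp
        intro j
        fin_cases j
        · simp only [hx, Fin.zero_eta, Matrix.cons_val]
          rw [eq_div_iff hρ]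
          exact sub_eq_zero.1 h1
        · simp only [hx, Fin.mk_one, Matrix.cons_val]
          rw [eq_div_iff hρ]
          exact sub_eq_zero.1 h2
        · simpa [hx] using sub_eq_zero.1 h4
    funext k
    rcases k with i | j
    · fin_cases i <;> rfl
    · exact hq j

theorem isSemianalytic_of_eq_and_pos {ι : Type} [Fintype ι] {g h : (ι → ℝ) → ℝ}
    (hg : ContDiff ℝ ⊤ g) (hh : ContDiff ℝ ⊤ h) : IsSemianalytic {x | g x = 0 ∧ 0 < h x} := by
  refine fun x => ⟨univ, isOpen_univ, mem_univ _, {x | x ∈ univ ∧ g x = 0} ⊓ {x | x ∈ univ ∧ 0 < h x},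
    BooleanSubalgebra.inf_mem (BooleanSubalgebra.subset_closure ?_)
      (BooleanSubalgebra.subset_closure ?_), ?_⟩
  -- Here the smoothness exponent `⊤` is `ω`, that is, analyticity.
  · exact ⟨g, fun y _ => hg.contDiffAt.analyticAt, Or.inl rfl⟩
  · exact ⟨h, fun y _ => hh.contDiffAt.analyticAt, Or.inr rfl⟩
  · ext y
    simp

theorem isSubanalytic_of_eq_zero {ι : Type} [Fintype ι] {g : (ι → ℝ) → ℝ}
    (hg : ContDiff ℝ ⊤ g) : IsSubanalytic {x | g x = 0} := by
  intro x
  -- No extra variables are needed (`m = 0`): intersecting with a Euclidean unit ball already gives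
  -- a bounded semianalytic set.
  refine ⟨{y | 0 < 1 - ∑ i, (y i - x i) ^ 2}, isOpen_lt continuous_const (by fun_prop), by simp, 0,
    {y | g (fun i => y (.inl i)) = 0 ∧ 0 < 1 - ∑ i, (y (.inl i) - x i) ^ 2}, ?_,
    isSemianalytic_of_eq_and_pos (hg.comp (by fun_prop)) (by fun_prop), ?_⟩
  · refine (Metric.isBounded_iff_subset_closedBall 0).2 ⟨‖x‖ + 1, fun y hy => ?_⟩
    rw [mem_closedBall_zero_iff, pi_norm_le_iff_of_nonneg (by positivity)]
    rintro (i | k)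
    · have h1 : (y (.inl i) - x i) ^ 2 ≤ ∑ i, (y (.inl i) - x i) ^ 2 :=
        Finset.single_le_sum (f := fun i => (y (.inl i) - x i) ^ 2) (fun j _ => sq_nonneg _)
          (Finset.mem_univ i)
      have h2 : |y (.inl i) - x i| ≤ 1 := by
        rw [← sq_le_one_iff_abs_le_one]
        linarith [hy.2]
      have h3 : ‖y (.inl i)‖ ≤ ‖x i‖ + ‖y (.inl i) - x i‖ := by
        simpa using norm_add_le (x i) (y (.inl i) - x i)
      exact h3.trans (add_le_add (norm_le_pi_norm x i) h2)
    · exact k.elim0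
  · ext y
    constructor
    · rintro ⟨h1, h2⟩
      exact ⟨Sum.elim y Fin.elim0, ⟨h1, h2⟩, rfl⟩
    · rintro ⟨z, ⟨h1, h2⟩, rfl⟩
      exact ⟨h1, h2⟩

theorem isTameOn_threeSheeted : IsTameOn threeSheeted univ := by
  refine Or.inr ?_
  rw [show graphOn threeSheeted univ = {p | _} from Set.ext fun p => mem_graphOn_threeSheeted]
  exact isSubanalytic_of_eq_zero (by fun_prop)

/-! ### Null-homotopy of the differential in `GL(3, ℝ)`. -/

/-- The rotation of `ℝ³` about the third coordinate axis by an angle with cosine `c` and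
sine `s`. -/
def rotThird {c s : ℝ} (h : c ^ 2 + s ^ 2 = 1) : Matrix.GeneralLinearGroup (Fin 3) ℝ where
  val := !![c, -s, 0; s, c, 0; 0, 0, 1]
  inv := !![c, s, 0; -s, c, 0; 0, 0, 1]
  val_inv := by
    ext i j
    fin_cases i <;> fin_cases j <;> simp [Matrix.mul_apply, Fin.sum_univ_three] <;>
      first | ring1 | linear_combination h
  inv_val := by
    ext i j
    fin_cases i <;> fin_cases j <;> simp [Matrix.mul_apply, Fin.sum_univ_three] <;>
      first | ring1 | linear_combination h

/-- The rotation of `ℝ³` about the first coordinate axis by the angle `t`. -/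
noncomputable def rotFirst (t : ℝ) : Matrix.GeneralLinearGroup (Fin 3) ℝ where
  val := !![1, 0, 0; 0, Real.cos t, -Real.sin t; 0, Real.sin t, Real.cos t]
  inv := !![1, 0, 0; 0, Real.cos t, Real.sin t; 0, -Real.sin t, Real.cos t]
  val_inv := by
    ext i j
    fin_cases i <;> fin_cases j <;> simp [Matrix.mul_apply, Fin.sum_univ_three] <;>
      first | ring1 | linear_combination Real.cos_sq_add_sin_sq t
  inv_val := by
    ext i j
    fin_cases i <;> fin_cases j <;> simp [Matrix.mul_apply, Fin.sum_univ_three] <;>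
      first | ring1 | linear_combination Real.cos_sq_add_sin_sq t

/-- The dilation of the second coordinate of `ℝ³` by a factor `a`. -/
noncomputable def dilSecond {a : ℝ} (h : a ≠ 0) : Matrix.GeneralLinearGroup (Fin 3) ℝ where
  val := !![1, 0, 0; 0, a, 0; 0, 0, 1]
  inv := !![1, 0, 0; 0, a⁻¹, 0; 0, 0, 1]
  val_inv := by
    ext i j
    fin_cases i <;> fin_cases j <;> simp [Matrix.mul_apply, Fin.sum_univ_three, h]
  inv_val := by
    ext i j
    fin_cases i <;> fin_cases j <;> simp [Matrix.mul_apply, Fin.sum_univ_three, h]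

/-- A half-turn about the first axis reverses the third axis, and with it the sense of rotation.
This is what contracts the square of the rotation loop. -/
theorem rotFirst_pi_conj {c s : ℝ} (h : c ^ 2 + s ^ 2 = 1) :
    rotFirst Real.pi * rotThird h * (rotFirst Real.pi)⁻¹ = (rotThird h)⁻¹ := by
  ext i j
  change ((rotFirst Real.pi).val * (rotThird h).val * (rotFirst Real.pi).inv) i j = (rotThird h).inv i j
  fin_cases i <;> fin_cases j <;>
    simp [rotFirst, rotThird, Matrix.mul_apply, Fin.sum_univ_three]

theorem rotFirst_zero : rotFirst 0 = 1 := by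
  ext i j
  fin_cases i <;> fin_cases j <;> simp [rotFirst]

theorem dilSecond_one : dilSecond one_ne_zero = 1 := by
  ext i j
  fin_cases i <;> fin_cases j <;> simp [dilSecond]

/-- In polar coordinates the radial direction at angle `φ` goes to that at `3φ`, and the tangential
one likewise, stretched by `3`. -/
theorem threeSheetedJacobi_eq {p : EuclideanSpace ℝ (Fin 3)} {r c s : ℝ} (hr : r ≠ 0)
    (hc : p 0 = r * c) (hs : p 1 = r * s) (h : c ^ 2 + s ^ 2 = 1) :
    (rotThird h * rotThird h * (rotThird h * dilSecond three_ne_zero * (rotThird h)⁻¹)).val =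
      threeSheetedJacobi p := by
  have hρ : (p 0) ^ 2 + (p 1) ^ 2 = r ^ 2 := by
    rw [hc, hs]
    linear_combination r ^ 2 * h
  change (rotThird h).val * (rotThird h).val * ((rotThird h).val * (dilSecond three_ne_zero).val *
    (rotThird h).inv) = _
  simp only [threeSheetedJacobi, hρ]
  simp only [hc, hs]
  ext i j
  fin_cases i <;> fin_cases j <;>
    simp [rotThird, dilSecond, Matrix.mul_apply, Fin.sum_univ_three] <;>
    field_simp <;> ring

theorem nullhomotopicDifferentialOn_threeSheeted :
    NullhomotopicDifferentialOn threeSheeted (criticalSet threeSheeted univ)ᶜ := by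
  rw [criticalSet_threeSheeted]
  set S : Set (EuclideanSpace ℝ (Fin 3)) := {p | p 0 = 0 ∧ p 1 = 0}ᶜ with hS
  have hρ : ∀ p : S, 0 < (p.1 0) ^ 2 + (p.1 1) ^ 2 := fun p =>
    lt_of_le_of_ne (by positivity) (sq_add_sq_ne_zero_of_not_and p.2).symm
  let r : S → ℝ := fun p => √((p.1 0) ^ 2 + (p.1 1) ^ 2)
  have hr : ∀ p, r p ≠ 0 := fun p => (Real.sqrt_pos.2 (hρ p)).ne'
  have hrc : Continuous r := by fun_prop
  have hcs : ∀ p : S, (p.1 0 / r p) ^ 2 + (p.1 1 / r p) ^ 2 = 1 := fun p => by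
    have h1 : r p ^ 2 = (p.1 0) ^ 2 + (p.1 1) ^ 2 := Real.sq_sqrt (hρ p).le
    rw [div_pow, div_pow, ← add_div, h1, div_self (hρ p).ne']
  have hcc : Continuous fun p : S => p.1 0 / r p := Continuous.div (by fun_prop) hrc hr
  have hsc : Continuous fun p : S => p.1 1 / r p := Continuous.div (by fun_prop) hrc hr
  have hR : Continuous fun p : S => rotThird (hcs p) := by
    rw [Units.continuous_iff]
    constructor <;> refine continuous_matrix fun i j => ?_ <;>
      fin_cases i <;> fin_cases j <;> simp [rotThird] <;> fun_prop
  have hA : Continuous rotFirst := by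
    rw [Units.continuous_iff]
    constructor <;> refine continuous_matrix fun i j => ?_ <;>
      fin_cases i <;> fin_cases j <;> simp [rotFirst] <;> fun_prop
  have hane : ∀ t : unitInterval, (3 - 2 * t : ℝ) ≠ 0 := fun t => by
    have := t.2.2
    linarith
  have hd : Continuous fun t : unitInterval => dilSecond (hane t) := by
    rw [Units.continuous_iff]
    constructor <;> refine continuous_matrix fun i j => ?_ <;>
      fin_cases i <;> fin_cases j <;> simp [dilSecond] <;> fun_prop (disch := exact hane)
  -- Conjugation by a rotation through `πt` turns the second factor into the inverse of the first,
  -- while the stretch factor `3 - 2t` falls to `1`; at `t = 1` everything cancels.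
  let H : unitInterval × S → Matrix.GeneralLinearGroup (Fin 3) ℝ := fun x =>
    rotThird (hcs x.2) * (rotFirst (Real.pi * x.1) * rotThird (hcs x.2) *
      (rotFirst (Real.pi * x.1))⁻¹) *
      (rotThird (hcs x.2) * dilSecond (hane x.1) * (rotThird (hcs x.2))⁻¹)
  have hHc : Continuous H := by
    have h1 := hR.comp (continuous_snd : Continuous fun x : unitInterval × S => x.2)
    have h2 : Continuous fun x : unitInterval × S => rotFirst (Real.pi * x.1) :=
      hA.comp (by fun_prop)
    have h3 := hd.comp (continuous_fst : Continuous fun x : unitInterval × S => x.1)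
    exact (h1.mul ((h2.mul h1).mul h2.inv)).mul ((h1.mul h3).mul h1.inv)
  refine ⟨⟨fun p => H (0, p), hHc.comp (by fun_prop)⟩, fun p => ?_, 1, ⟨⟨⟨H, hHc⟩, fun p => rfl, ?_⟩⟩⟩
  · rw [jacobi_threeSheeted p.2, ← threeSheetedJacobi_eq (hr p) (mul_div_cancel₀ _ (hr p)).symm
      (mul_div_cancel₀ _ (hr p)).symm (hcs p)]
    simp [H, rotFirst_zero]
  · intro p
    have h1 : ∀ (a : ℝ) (ha : a ≠ 0), a = 1 → dilSecond ha = 1 := by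
      rintro a ha rfl
      exact dilSecond_one
    simp only [H]
    rw [h1 _ (hane _) (by norm_num)]
    simp [rotFirst_pi_conj]

end TameMap

end

theorem proposition7p1 :
    (∀ (U : Set (EuclideanSpace ℝ (Fin 2)))
        (f : EuclideanSpace ℝ (Fin 2) → EuclideanSpace ℝ (Fin 2)),
      IsOpen U → 0 ∈ U → ContinuousOn f U → TameMap.IsTameOn f U →
      TameMap.criticalSet f U ⊆ {0} →
      {x | x ∈ U ∧ f x = 0} = {0} →
      TameMap.NullhomotopicDifferentialOn f (U \ {0}) →
      TameMap.IsHomeomorphGerm f) ∧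
    (Continuous TameMap.threeSheeted ∧
      TameMap.IsTameOn TameMap.threeSheeted Set.univ ∧
      TameMap.criticalSet TameMap.threeSheeted Set.univ = {p | p 0 = 0 ∧ p 1 = 0} ∧
      TameMap.threeSheeted ⁻¹' {0} = {0} ∧
      TameMap.NullhomotopicDifferentialOn TameMap.threeSheeted
        (TameMap.criticalSet TameMap.threeSheeted Set.univ)ᶜ ∧
      ¬ TameMap.IsHomeomorphGerm TameMap.threeSheeted) :=
  ⟨fun _ _ hU h0 hc _ hcrit hf hnull =>
      TameMap.isHomeomorphGerm_of_nullhomotopic hU h0 hc hcrit hf hnull,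
    TameMap.continuous_threeSheeted, TameMap.isTameOn_threeSheeted,
    TameMap.criticalSet_threeSheeted, TameMap.threeSheeted_preimage_zero,
    TameMap.nullhomotopicDifferentialOn_threeSheeted, TameMap.not_isHomeomorphGerm_threeSheeted⟩
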